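/- Let $K\subset \mathrm{O}(n)$ be a compact subgroup, acting on $\mathbb R^n$ by matrix-vector multiplication, and let $\rho_1,\dots,\rho_\ell$ generate the real algebra $\mathcal P(\mathbb R^n)^K$ of polynomials $p$ on $\mathbb R^n$ with real coefficients that satisfy $p(k\cdot x)=p(x)$ for all $k\in K$, $x\in\mathbb R^n$. Write $\rho(x)=(\rho_1(x),\dots,\rho_\ell(x))\in\mathbb R^\ell$, and for $\xi\in\mathbb R^n$ let $$\varphi_\xi(x)=\int_K e^{i\langle x,k\cdot\xi\rangle}\,dk\qquad(x\in\mathbb R^n)$$ be the associated bounded spherical function, where $dk$ is the normalized Haar measure on $K$. Then: 1. For every $\xi\in\mathbb R^n$ there is a real analytic function $h_\xi:\mathbb R^\ell\to\mathbb C$ such that $\varphi_\xi(x)=h_\xi(\rho_1(x),\dots,\rho_\ell(x))$ for all $x\in\mathbb R^n$. 2. If, moreover, the generators $\rho_1,\dots,\rho_\ell$ are homogeneous polynomials, then there is a family of polynomials $q_J\in\mathbb C[s_1,\dots,s_\ell]$, indexed by the multi-indices $J=(j_1,\dots,j_\ell)\in\mathbb N^\ell$ and not depending on $\xi$, such that for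 every $\xi\in\mathbb R^n$ the function $h_\xi$ in 1 can be chosen to be $$h_\xi(t)=\sum_{J} q_J(\rho(\xi))\,t_1^{j_1}\cdots t_\ell^{j_\ell}\qquad(t\in\mathbb R^\ell),$$ where the series converges absolutely for every $t\in\mathbb R^\ell$. -/

import Mathlib

open MeasureTheory
open scoped Matrix

/-- The normalized Haar measure (total mass one) on a compact subgroup `K` of `O(n)`,
on the Borel σ-algebra of `K`. -/
noncomputable def normalizedHaar {n : ℕ} (K : Subgroup (Matrix.orthogonalGroup (Fin n) ℝ))
    (hK : IsCompact (K : Set (Matrix.orthogonalGroup (Fin n) ℝ))) :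
    @Measure K (borel K) :=
  letI : MeasurableSpace K := borel K
  haveI : BorelSpace K := ⟨rfl⟩
  haveI : CompactSpace K := isCompact_iff_compactSpace.mp hK
  Measure.haarMeasure ⊤

/-- The bounded spherical function `φ_ξ(x) = ∫_K e^{i⟨x, k·ξ⟩} dk` of the Gelfand pair
`(K, ℝⁿ)`, where `dk` is the normalized Haar measure on `K`. -/
noncomputable def sphericalFunction {n : ℕ} (K : Subgroup (Matrix.orthogonalGroup (Fin n) ℝ))
    (hK : IsCompact (K : Set (Matrix.orthogonalGroup (Fin n) ℝ)))
    (ξ x : Fin n → ℝ) : ℂ :=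
  letI : MeasurableSpace K := borel K
  ∫ k : K, Complex.exp (Complex.I * ((x ⬝ᵥ ((k : Matrix (Fin n) (Fin n) ℝ) *ᵥ ξ) : ℝ) : ℂ))
    ∂(normalizedHaar K hK)

/-- The algebra `𝒫(ℝⁿ)^K` of real polynomials `p` on `ℝⁿ` with `p(k·x) = p(x)` for all
`k ∈ K` and `x ∈ ℝⁿ`. -/
def invariantPolynomials {n : ℕ} (K : Subgroup (Matrix.orthogonalGroup (Fin n) ℝ)) :
    Subalgebra ℝ (MvPolynomial (Fin n) ℝ) where
  carrier := {p | ∀ k ∈ K, ∀ x : Fin n → ℝ,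
    MvPolynomial.eval ((k : Matrix (Fin n) (Fin n) ℝ) *ᵥ x) p = MvPolynomial.eval x p}
  mul_mem' := fun hp hq k hk x => by rw [map_mul, map_mul, hp k hk x, hq k hk x]
  add_mem' := fun hp hq k hk x => by rw [map_add, map_add, hp k hk x, hq k hk x]
  algebraMap_mem' := fun r k _ x => by simp [MvPolynomial.algebraMap_eq]

/-- The map `ρ = (ρ_1, …, ρ_ℓ) : ℝⁿ → ℝ^ℓ` given by a tuple of polynomials. -/
noncomputable def polyMap {n ℓ : ℕ} (ρ : Fin ℓ → MvPolynomial (Fin n) ℝ) (x : Fin n → ℝ) :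
    Fin ℓ → ℝ :=
  fun j => MvPolynomial.eval x (ρ j)

/-! Expand the exponential under the integral. The degree-`m` term is `i^m/m!` times `P_m(x) = ∫ ⟨x,
kξ⟩^m dk`, an invariant polynomial in `x`, homogeneous of degree `m`, whose ℓ¹ coefficient norm at
polyradius `r` is at most `(‖ξ‖₁ ∑ r_i)^m` (`l1Norm_sum_words_le`). Each `P_m` is a polynomial in
the `ρ_j`, but an arbitrary choice of these polynomials could have coefficients too large for the
series to converge.

The remedy is a single linear section `s` of `T_j ↦ ρ_j` such that every `B` admits an `r` with `‖s
p‖_B ≤ ‖p‖_r` for all `p` (`exists_adjoin_section`). Then `∑ i^m/m! · s(P_m)` is dominated by an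
exponential series on every polydisc and rearranges into an everywhere convergent power series
(`exists_analytic_hasSum`).

The section is reduction to normal form modulo the kernel of `(X, T) ↦ (X, ρ)`, for a lex order
eliminating `X`. Reduction does not increase the ℓ¹ norm at polyradii where each leading term of the
Gröbner basis dominates the rest of its polynomial; `exists_radii_lex` finds such polyradii with all
entries above any bound.

For homogeneous generators, give `T_j` the weight `deg ρ_j` and keep only the weight-`m` part of
`s(P_m)`. A monomial `T^J` then occurs for one `m` only, so its coefficient is a finite combination
of averages over `K` of monomials in `kξ`. These are invariant in `ξ`, hence polynomials in `ρ(ξ)`.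
-/

namespace MvPolynomial

open scoped MonomialOrder

/-! ### Weighted ℓ¹ norms of polynomials -/

section L1Norm

variable {σ τ 𝕜 : Type*} [NormedField 𝕜]

/-- The value of the monomial with exponent `a` at the polyradius `r`. -/
noncomputable def radiusPow (r : σ → ℝ) (a : σ →₀ ℕ) : ℝ := a.prod fun i e => r i ^ e

theorem radiusPow_nonneg {r : σ → ℝ} (hr : ∀ i, 0 ≤ r i) (a : σ →₀ ℕ) : 0 ≤ radiusPow r a :=
  Finset.prod_nonneg fun i _ => pow_nonneg (hr i) _

theorem radiusPow_add (r : σ → ℝ) (a b : σ →₀ ℕ) :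
    radiusPow r (a + b) = radiusPow r a * radiusPow r b := by
  classical
  exact Finsupp.prod_add_index' (by simp) (by intros; rw [pow_add])

/-- The `ℓ¹` norm of a polynomial with respect to the polyradius `r`. -/
noncomputable def l1Norm (r : σ → ℝ) (f : MvPolynomial σ 𝕜) : ℝ :=
  ∑ a ∈ f.support, ‖coeff a f‖ * radiusPow r a

theorem l1Norm_eq_sum (r : σ → ℝ) {f : MvPolynomial σ 𝕜} {s : Finset (σ →₀ ℕ)}
    (h : f.support ⊆ s) : l1Norm r f = ∑ a ∈ s, ‖coeff a f‖ * radiusPow r a :=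
  Finset.sum_subset h fun a _ ha => by rw [notMem_support_iff.mp ha]; simp

theorem l1Norm_nonneg {r : σ → ℝ} (hr : ∀ i, 0 ≤ r i) (f : MvPolynomial σ 𝕜) : 0 ≤ l1Norm r f :=
  Finset.sum_nonneg fun a _ => mul_nonneg (norm_nonneg _) (radiusPow_nonneg hr a)

@[simp] theorem l1Norm_zero (r : σ → ℝ) : l1Norm r (0 : MvPolynomial σ 𝕜) = 0 := by
  simp [l1Norm]

theorem l1Norm_monomial (r : σ → ℝ) (a : σ →₀ ℕ) (c : 𝕜) :
    l1Norm r (monomial a c) = ‖c‖ * radiusPow r a := by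
  classical
  rw [l1Norm_eq_sum r (s := {a}) (support_monomial_subset)]
  simp

theorem l1Norm_add_le {r : σ → ℝ} (hr : ∀ i, 0 ≤ r i) (f g : MvPolynomial σ 𝕜) :
    l1Norm r (f + g) ≤ l1Norm r f + l1Norm r g := by
  classical
  rw [l1Norm_eq_sum r (s := f.support ∪ g.support) support_add,
    l1Norm_eq_sum r (s := f.support ∪ g.support) Finset.subset_union_left,
    l1Norm_eq_sum r (f := g) (s := f.support ∪ g.support) Finset.subset_union_right,
    ← Finset.sum_add_distrib]
  refine Finset.sum_le_sum fun a _ => ?_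
  rw [← add_mul, coeff_add]
  exact mul_le_mul_of_nonneg_right (norm_add_le _ _) (radiusPow_nonneg hr a)

theorem l1Norm_sum_le {r : σ → ℝ} (hr : ∀ i, 0 ≤ r i) {ι : Type*} (s : Finset ι)
    (f : ι → MvPolynomial σ 𝕜) : l1Norm r (∑ i ∈ s, f i) ≤ ∑ i ∈ s, l1Norm r (f i) := by
  classical
  induction s using Finset.induction_on with
  | empty => simp
  | insert i s hi ih =>
    rw [Finset.sum_insert hi, Finset.sum_insert hi]
    exact (l1Norm_add_le hr _ _).trans (by gcongr)

theorem l1Norm_mul_le {r : σ → ℝ} (hr : ∀ i, 0 ≤ r i) (f g : MvPolynomial σ 𝕜) :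
    l1Norm r (f * g) ≤ l1Norm r f * l1Norm r g := by
  classical
  have : f * g = ∑ a ∈ f.support, ∑ b ∈ g.support,
      monomial (a + b) (coeff a f * coeff b g) := by
    conv_lhs => rw [f.as_sum, g.as_sum]
    simp only [Finset.sum_mul_sum, monomial_mul]
  rw [this, l1Norm.eq_def r f, l1Norm.eq_def r g, Finset.sum_mul_sum]
  refine (l1Norm_sum_le hr _ _).trans (Finset.sum_le_sum fun a _ => ?_)
  refine (l1Norm_sum_le hr _ _).trans (Finset.sum_le_sum fun b _ => ?_)
  rw [l1Norm_monomial, radiusPow_add, norm_mul]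
  exact le_of_eq (by ring)

theorem l1Norm_C (r : σ → ℝ) (c : 𝕜) : l1Norm r (C c : MvPolynomial σ 𝕜) = ‖c‖ := by
  rw [C_apply, l1Norm_monomial]; simp [radiusPow]

theorem l1Norm_X (r : σ → ℝ) (i : σ) : l1Norm r (X i : MvPolynomial σ 𝕜) = r i := by
  rw [X, l1Norm_monomial]; simp [radiusPow]

theorem l1Norm_prod_le {r : σ → ℝ} (hr : ∀ i, 0 ≤ r i) {ι : Type*} (s : Finset ι)
    (f : ι → MvPolynomial σ 𝕜) : l1Norm r (∏ i ∈ s, f i) ≤ ∏ i ∈ s, l1Norm r (f i) := by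
  classical
  induction s using Finset.induction_on with
  | empty => simpa using (l1Norm_C r (1 : 𝕜)).le
  | insert i s hi ih =>
    rw [Finset.prod_insert hi, Finset.prod_insert hi]
    exact (l1Norm_mul_le hr _ _).trans
      (mul_le_mul_of_nonneg_left ih (l1Norm_nonneg hr _))

theorem l1Norm_pow_le {r : σ → ℝ} (hr : ∀ i, 0 ≤ r i) (f : MvPolynomial σ 𝕜) (k : ℕ) :
    l1Norm r (f ^ k) ≤ l1Norm r f ^ k := by
  simpa using l1Norm_prod_le hr (Finset.range k) (fun _ => f)

theorem l1Norm_C_mul_le {r : σ → ℝ} (hr : ∀ i, 0 ≤ r i) (c : 𝕜) (f : MvPolynomial σ 𝕜) :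
    l1Norm r (C c * f) ≤ ‖c‖ * l1Norm r f := by
  simpa [l1Norm_C] using l1Norm_mul_le hr (C c) f

/-- By submultiplicativity, substitution is contractive once the radius of each variable is at least
the norm of its image. -/
theorem l1Norm_aeval_le {r : σ → ℝ} {s : τ → ℝ} (hr : ∀ i, 0 ≤ r i)
    {g : τ → MvPolynomial σ 𝕜} (hg : ∀ j, l1Norm r (g j) ≤ s j) (f : MvPolynomial τ 𝕜) :
    l1Norm r (aeval g f) ≤ l1Norm s f := by
  rw [aeval_def, eval₂_eq, l1Norm]
  refine (l1Norm_sum_le hr _ _).trans (Finset.sum_le_sum fun a _ => ?_)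
  refine (l1Norm_C_mul_le hr _ _).trans (mul_le_mul_of_nonneg_left ?_ (norm_nonneg _))
  refine (l1Norm_prod_le hr _ _).trans (Finset.prod_le_prod (fun j _ => l1Norm_nonneg hr _)
    fun j _ => ?_)
  exact (l1Norm_pow_le hr _ _).trans (pow_le_pow_left₀ (l1Norm_nonneg hr _) (hg j) _)

end L1Norm

/-! ### Gröbner bases and norm-controlled reduction -/

section NormalForm

variable {σ 𝕜 : Type*} [NormedField 𝕜] (m : MonomialOrder σ)

/-- `G` is a finite set of monic elements of `I` whose leading monomials generate all leading
monomials of `I`. -/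
structure IsMonicGroebner (I : Ideal (MvPolynomial σ 𝕜)) (G : Finset (MvPolynomial σ 𝕜)) :
    Prop where
  mem : ∀ g ∈ G, g ∈ I
  monic : ∀ g ∈ G, m.Monic g
  exists_degree_le : ∀ f ∈ I, f ≠ 0 → ∃ g ∈ G, m.degree g ≤ m.degree f

/-- Dickson's lemma: the minimal leading exponents form an antichain in a well-quasi-order, hence a
finite set. -/
theorem exists_isMonicGroebner [Finite σ] (I : Ideal (MvPolynomial σ 𝕜)) :
    ∃ G, IsMonicGroebner m I G := by
  classical
  let U : Set (σ →₀ ℕ) := {a | ∃ f ∈ I, m.Monic f ∧ m.degree f = a}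
  have hfin : {a | Minimal (· ∈ U) a}.Finite :=
    WellQuasiOrderedLE.finite_of_isAntichain (setOfPred_minimal_antichain _)
  have hch : ∀ a : {a | Minimal (· ∈ U) a}, ∃ f ∈ I, m.Monic f ∧ m.degree f = a :=
    fun a => a.2.1
  choose g hgI hgm hgd using hch
  have : Fintype {a | Minimal (· ∈ U) a} := hfin.fintype
  refine ⟨Finset.univ.image g, ?_, ?_, ?_⟩
  · simp only [Finset.mem_image, Finset.mem_univ, true_and, forall_exists_index,
      forall_apply_eq_imp_iff]
    exact hgI
  · simp only [Finset.mem_image, Finset.mem_univ, true_and, forall_exists_index,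
      forall_apply_eq_imp_iff]
    exact hgm
  · intro f hf hf0
    have hc : m.leadingCoeff f ≠ 0 := m.leadingCoeff_ne_zero_iff.mpr hf0
    have hU : m.degree f ∈ U := by
      have hd : m.degree (C (m.leadingCoeff f)⁻¹ * f) = m.degree f := by
        rw [m.degree_mul (by simpa using hc) hf0, m.degree_C, zero_add]
      refine ⟨C (m.leadingCoeff f)⁻¹ * f, I.mul_mem_left _ hf, ?_, hd⟩
      rw [MonomialOrder.Monic, m.leadingCoeff_mul, m.leadingCoeff_C, inv_mul_cancel₀ hc]
    obtain ⟨a, haf, ha⟩ := exists_minimal_le_of_wellFoundedLT (· ∈ U) _ hU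
    exact ⟨g ⟨a, ha⟩, by simp, by rw [hgd]; exact haf⟩

variable {m}

/-- Well-founded induction along the division algorithm. `ν` is chosen before `r`, so one reduction
serves all admissible polyradii at once. -/
theorem exists_normalForm_monomial {I : Ideal (MvPolynomial σ 𝕜)}
    {G : Finset (MvPolynomial σ 𝕜)} (hG : IsMonicGroebner m I G) (a : σ →₀ ℕ) :
    ∃ ν : MvPolynomial σ 𝕜, monomial a 1 - ν ∈ I ∧
      (∀ b ∈ ν.support, (∀ g ∈ G, ¬ m.degree g ≤ b) ∧ b ≼[m] a) ∧
      ∀ r : σ → ℝ, (∀ i, 0 ≤ r i) →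
        (∀ g ∈ G, l1Norm r (monomial (m.degree g) 1 - g) ≤ radiusPow r (m.degree g)) →
        l1Norm r ν ≤ radiusPow r a := by
  classical
  induction hs : m.toSyn a using WellFoundedLT.induction generalizing a with
  | _ x ih =>
  subst hs
  by_cases hred : ∃ g ∈ G, m.degree g ≤ a
  · obtain ⟨g, hg, hga⟩ := hred
    -- One division step: `h` is congruent to the monomial `a` modulo `g`, has only smaller
    -- exponents, and by dominance has norm at most `radiusPow r a`.
    set h : MvPolynomial σ 𝕜 := monomial (a - m.degree g) 1 * (monomial (m.degree g) 1 - g)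
      with hh
    have hlt : ∀ b ∈ h.support, b ≺[m] a := by
      intro b hb
      obtain ⟨c, hc, d, hd, rfl⟩ := Finset.mem_add.mp (support_mul _ _ hb)
      obtain rfl : c = a - m.degree g := by
        simpa using support_monomial_subset hc
      have hdle : d ≺[m] m.degree g := by
        have hne : d ≠ m.degree g := by
          rintro rfl
          rw [mem_support_iff, coeff_sub, (hG.monic g hg).coeff_degree] at hd
          simp at hd
        have hdg : d ∈ g.support := by
          rw [mem_support_iff, coeff_sub, coeff_monomial, if_neg hne.symm, zero_sub,
            neg_ne_zero] at hd
          exact mem_support_iff.mpr hd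
        exact lt_of_le_of_ne (m.le_degree hdg) fun he => hne (m.toSyn.injective he)
      calc m.toSyn (a - m.degree g + d) = m.toSyn (a - m.degree g) + m.toSyn d := map_add _ _ _
        _ < m.toSyn (a - m.degree g) + m.toSyn (m.degree g) := by gcongr
        _ = m.toSyn a := by rw [← map_add, tsub_add_cancel_of_le hga]
    have ih' : ∀ b : h.support, _ := fun b => ih (m.toSyn b) (hlt b b.2) b rfl
    choose ν hν₁ hν₂ hν₃ using ih'
    refine ⟨∑ b : h.support, C (coeff b h) * ν b, ?_, ?_, ?_⟩
    · have h1 : monomial a 1 - h = monomial (a - m.degree g) 1 * g := by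
        rw [hh, mul_sub, monomial_mul, tsub_add_cancel_of_le hga, one_mul]; ring
      have h2 : h - ∑ b : h.support, C (coeff b h) * ν b
          = ∑ b : h.support, C (coeff b h) * (monomial (b : σ →₀ ℕ) 1 - ν b) := by
        simp only [mul_sub, Finset.sum_sub_distrib, C_mul_monomial, mul_one]
        congr 1
        rw [Finset.sum_coe_sort h.support (fun b => monomial b (coeff b h))]
        exact h.as_sum
      rw [← sub_add_sub_cancel _ h, h1, h2]
      exact I.add_mem (I.mul_mem_left _ (hG.mem g hg))
        (I.sum_mem fun b _ => I.mul_mem_left _ (hν₁ b))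
    · intro b hb
      obtain ⟨c, _, hc⟩ := Finset.mem_biUnion.mp (support_sum hb)
      have hbc : b ∈ (ν c).support := by
        rw [mem_support_iff, coeff_C_mul] at hc
        exact mem_support_iff.mpr (right_ne_zero_of_mul hc)
      exact ⟨(hν₂ c b hbc).1, (hν₂ c b hbc).2.trans (hlt c c.2).le⟩
    · intro r hr hgood
      calc l1Norm r (∑ b : h.support, C (coeff b h) * ν b)
          ≤ ∑ b : h.support, ‖coeff b h‖ * radiusPow r b :=
            (l1Norm_sum_le hr _ _).trans (Finset.sum_le_sum fun b _ =>
              (l1Norm_C_mul_le hr _ _).trans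
                (mul_le_mul_of_nonneg_left (hν₃ b r hr hgood) (norm_nonneg _)))
        _ = l1Norm r h :=
            Finset.sum_coe_sort h.support (fun b => ‖coeff b h‖ * radiusPow r b)
        _ ≤ radiusPow r (a - m.degree g) * radiusPow r (m.degree g) := by
            refine (l1Norm_mul_le hr _ _).trans ?_
            rw [l1Norm_monomial, norm_one, one_mul]
            exact mul_le_mul_of_nonneg_left (hgood g hg) (radiusPow_nonneg hr _)
        _ = radiusPow r a := by rw [← radiusPow_add, tsub_add_cancel_of_le hga]
  · push Not at hred
    refine ⟨monomial a 1, by simp, fun b hb => ?_, fun r _ _ => by simp [l1Norm_monomial]⟩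
    obtain rfl : b = a := by simpa using support_monomial_subset hb
    exact ⟨hred, le_rfl⟩

/-- Linear reduction to normal form modulo an ideal, which does not increase `ℓ¹` norms for
polyradii at which the leading terms of a Gröbner basis dominate. -/
theorem exists_normalForm {I : Ideal (MvPolynomial σ 𝕜)}
    {G : Finset (MvPolynomial σ 𝕜)} (hG : IsMonicGroebner m I G) :
    ∃ N : MvPolynomial σ 𝕜 →ₗ[𝕜] MvPolynomial σ 𝕜,
      (∀ f, f - N f ∈ I) ∧ (∀ f ∈ I, N f = 0) ∧
      (∀ f, ∀ b ∈ (N f).support, ∃ a ∈ f.support, b ≼[m] a) ∧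
      ∀ r : σ → ℝ, (∀ i, 0 ≤ r i) →
        (∀ g ∈ G, l1Norm r (monomial (m.degree g) 1 - g) ≤ radiusPow r (m.degree g)) →
        ∀ f, l1Norm r (N f) ≤ l1Norm r f := by
  classical
  choose ν hν₁ hν₂ hν₃ using exists_normalForm_monomial hG
  let N : MvPolynomial σ 𝕜 →ₗ[𝕜] MvPolynomial σ 𝕜 := (basisMonomials σ 𝕜).constr 𝕜 ν
  have hN : ∀ f, N f = ∑ a ∈ f.support, C (coeff a f) * ν a := by
    intro f
    conv_lhs => rw [f.as_sum, map_sum]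
    refine Finset.sum_congr rfl fun a _ => ?_
    rw [← mul_one (coeff a f), ← smul_eq_mul, ← smul_monomial, map_smul]
    have : N (monomial a 1) = ν a := by
      simpa [coe_basisMonomials] using (basisMonomials σ 𝕜).constr_basis 𝕜 ν a
    rw [this, smul_eq_mul, mul_one, smul_eq_C_mul]
  have hsupp : ∀ f, ∀ b ∈ (N f).support, ∃ a ∈ f.support, b ∈ (ν a).support := by
    intro f b hb
    rw [hN] at hb
    obtain ⟨a, ha, hc⟩ := Finset.mem_biUnion.mp (support_sum hb)
    rw [mem_support_iff, coeff_C_mul] at hc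
    exact ⟨a, ha, mem_support_iff.mpr (right_ne_zero_of_mul hc)⟩
  have hsub : ∀ f, f - N f ∈ I := by
    intro f
    have : f - N f = ∑ a ∈ f.support, C (coeff a f) * (monomial a 1 - ν a) := by
      simp only [mul_sub, Finset.sum_sub_distrib, C_mul_monomial, mul_one]
      rw [← f.as_sum, hN]
    rw [this]
    exact I.sum_mem fun a _ => I.mul_mem_left _ (hν₁ a)
  refine ⟨N, hsub, fun f hf => ?_, fun f b hb => ?_, fun r hr hgood f => ?_⟩
  -- A nonzero `N f` in `I` would have a leading exponent divisible by that of some `g`, but all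
  -- exponents of `N f` are irreducible.
  · by_contra hne
    have hNI : N f ∈ I := by
      have := I.sub_mem hf (hsub f)
      rwa [sub_sub_cancel] at this
    obtain ⟨g, hg, hle⟩ := hG.exists_degree_le _ hNI hne
    obtain ⟨a, _, ha⟩ := hsupp f _ (m.degree_mem_support hne)
    exact (hν₂ a _ ha).1 g hg hle
  · obtain ⟨a, ha, hb'⟩ := hsupp f b hb
    exact ⟨a, ha, (hν₂ a b hb').2⟩
  · rw [hN, l1Norm.eq_def r f]
    exact (l1Norm_sum_le hr _ _).trans (Finset.sum_le_sum fun a _ =>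
      (l1Norm_C_mul_le hr _ _).trans
        (mul_le_mul_of_nonneg_left (hν₃ a r hr hgood) (norm_nonneg _)))

end NormalForm

/-! ### Polyradii at which lex-leading terms dominate -/

section LexRadii

variable {σ 𝕜 : Type*} [NormedField 𝕜] [LinearOrder σ] [Fintype σ]

/-- One unit in position `i` outweighs any later positions with entries at most `M`, so these
weights realise lex on bounded exponents. -/
theorem exists_weight (M : ℕ) :
    ∃ w : σ → ℕ, ∀ i, w i = 1 + M * ∑ j with i < j, w j := by
  classical
  let F : (i : σ) → ((j : σ) → j > i → ℕ) → ℕ := fun i ih =>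
    1 + M * ∑ j ∈ (Finset.univ.filter (i < ·)).attach, ih j (Finset.mem_filter.mp j.2).2
  refine ⟨(wellFounded_gt (α := σ)).fix F, fun i => ?_⟩
  rw [WellFounded.fix_eq]
  simp only [F]
  rw [Finset.sum_attach (Finset.univ.filter (i < ·)) (fun j => (wellFounded_gt (α := σ)).fix F j)]

theorem weight_lt_of_lex_lt {M : ℕ} {w : σ → ℕ}
    (hw : ∀ i, w i = 1 + M * ∑ j with i < j, w j) {a b : σ →₀ ℕ} (hb : ∀ i, b i ≤ M)
    (hlt : b ≺[MonomialOrder.lex] a) : ∑ i, b i * w i + 1 ≤ ∑ i, a i * w i := by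
  classical
  rw [MonomialOrder.lex_lt_iff] at hlt
  obtain ⟨i, hi, hlt⟩ := hlt
  simp only [ofLex_toLex] at hi hlt
  have hsplit : ∀ f : σ → ℕ, ∑ j, f j = ∑ j with j < i, f j + f i + ∑ j with i < j, f j := by
    intro f
    rw [← Finset.sum_filter_add_sum_filter_not Finset.univ (· < i) f, add_assoc]
    congr 1
    have : (Finset.univ.filter fun j => ¬ j < i) = insert i (Finset.univ.filter (i < ·)) := by
      ext j; simp [le_iff_eq_or_lt, eq_comm]
    rw [this, Finset.sum_insert (by simp)]
  rw [hsplit, hsplit fun j => a j * w j]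
  have h1 : ∑ j with j < i, b j * w j = ∑ j with j < i, a j * w j :=
    Finset.sum_congr rfl fun j hj => by rw [hi j (by simpa using hj)]
  have h2 : ∑ j with i < j, b j * w j ≤ M * ∑ j with i < j, w j := by
    rw [Finset.mul_sum]
    exact Finset.sum_le_sum fun j _ => Nat.mul_le_mul_right _ (hb j)
  have h3 : (b i + 1) * w i ≤ a i * w i := Nat.mul_le_mul_right _ hlt
  have h4 := hw i
  rw [add_mul, one_mul] at h3
  rw [h1]
  omega

theorem exists_radii_lex (G : Finset (MvPolynomial σ 𝕜))
    (hG : ∀ g ∈ G, (MonomialOrder.lex (σ := σ)).Monic g) (B : ℝ) :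
    ∃ r : σ → ℝ, (∀ i, 0 ≤ r i) ∧ (∀ i, B ≤ r i) ∧
      ∀ g ∈ G, l1Norm r (monomial (MonomialOrder.lex.degree g) 1 - g) ≤
        radiusPow r (MonomialOrder.lex.degree g) := by
  classical
  obtain ⟨w, hw⟩ := exists_weight (σ := σ) (∑ g ∈ G, g.totalDegree)
  let S : MvPolynomial σ 𝕜 → ℝ := fun g =>
    l1Norm (fun _ => 1) (monomial (MonomialOrder.lex.degree g) 1 - g)
  have hS : ∀ g, 0 ≤ S g := fun g => l1Norm_nonneg (fun _ => zero_le_one) _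
  -- `L` must exceed `1`, `B` and the unweighted norm of every tail. A weight gap of one then gains
  -- a factor `L`, which absorbs the whole tail.
  let L : ℝ := 1 + |B| + ∑ g ∈ G, S g
  have hsum : 0 ≤ ∑ g ∈ G, S g := Finset.sum_nonneg fun g _ => hS g
  have hL1 : 1 ≤ L := by have := abs_nonneg B; simp only [L]; linarith
  have hLB : B ≤ L := by have := le_abs_self B; simp only [L]; linarith
  have hrad : ∀ a : σ →₀ ℕ, radiusPow (fun i => L ^ w i) a = L ^ ∑ i, a i * w i := by
    intro a
    rw [radiusPow, Finsupp.prod_fintype _ _ (by simp), ← Finset.prod_pow_eq_pow_sum]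
    exact Finset.prod_congr rfl fun i _ => by rw [← pow_mul, mul_comm]
  refine ⟨fun i => L ^ w i, fun i => by positivity, fun i => ?_, fun g hg => ?_⟩
  · exact hLB.trans (le_self_pow₀ hL1 (by rw [hw i]; omega))
  · have hSL : S g ≤ L := by
      have := Finset.single_le_sum (fun g _ => hS g) hg
      have := abs_nonneg B; simp only [L]; linarith
    set a := MonomialOrder.lex.degree g
    have hterm : ∀ b ∈ (monomial a 1 - g).support,
        L * radiusPow (fun i => L ^ w i) b ≤ radiusPow (fun i => L ^ w i) a := by
      intro b hb
      have hne : b ≠ a := by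
        rintro rfl
        rw [mem_support_iff, coeff_sub, (hG g hg).coeff_degree] at hb
        simp [a] at hb
      have hbg : b ∈ g.support := by
        rw [mem_support_iff, coeff_sub, coeff_monomial, if_neg hne.symm, zero_sub,
          neg_ne_zero] at hb
        exact mem_support_iff.mpr hb
      have hlt : b ≺[MonomialOrder.lex] a := lt_of_le_of_ne (MonomialOrder.lex.le_degree hbg)
        fun he => hne (MonomialOrder.lex.toSyn.injective he)
      have hbM : ∀ i, b i ≤ ∑ g ∈ G, g.totalDegree := fun i =>
        calc b i ≤ b.degree := Finsupp.le_degree i b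
          _ ≤ g.totalDegree := by
            rw [Finsupp.degree_eq_sum]
            simpa [Finsupp.sum_fintype] using le_totalDegree hbg
          _ ≤ _ := Finset.single_le_sum (f := fun g : MvPolynomial σ 𝕜 => g.totalDegree)
            (fun _ _ => Nat.zero_le _) hg
      rw [hrad, hrad, ← pow_succ']
      exact pow_le_pow_right₀ hL1 (weight_lt_of_lex_lt hw hbM hlt)
    have hLpos : 0 < L := by linarith
    have hpos : 0 ≤ radiusPow (fun i => L ^ w i) a :=
      radiusPow_nonneg (fun i => by positivity) a
    refine le_of_mul_le_mul_left ?_ hLpos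
    calc L * l1Norm (fun i => L ^ w i) (monomial a 1 - g)
        ≤ S g * radiusPow (fun i => L ^ w i) a := by
          simp only [l1Norm, S, Finset.mul_sum, Finset.sum_mul]
          refine Finset.sum_le_sum fun b hb => ?_
          have h1 : radiusPow (fun _ => (1 : ℝ)) b = 1 := by simp [radiusPow]
          rw [h1, mul_one, mul_left_comm]
          exact mul_le_mul_of_nonneg_left (hterm b hb) (norm_nonneg _)
      _ ≤ L * radiusPow (fun i => L ^ w i) a := mul_le_mul_of_nonneg_right hSL hpos

end LexRadii

/-! ### Elimination and the bounded linear section -/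

theorem lex_inl_free_of_le {α β : Type*} [LinearOrder α] [LinearOrder β] [WellFoundedGT (α ⊕ₗ β)]
    {a b : (α ⊕ₗ β) →₀ ℕ} (hab : b ≼[MonomialOrder.lex] a)
    (ha : ∀ i, a (Sum.inlₗ i) = 0) (i : α) : b (Sum.inlₗ i) = 0 := by
  rcases eq_or_lt_of_le hab with h | h
  · rw [MonomialOrder.lex.toSyn.injective h]; exact ha i
  · rw [MonomialOrder.lex_lt_iff] at h
    obtain ⟨j, hj, hlt⟩ := h
    simp only [ofLex_toLex] at hj hlt
    have hij : Sum.inlₗ i < j := by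
      induction j using Lex.rec with
      | _ j =>
      cases j with
      | inl j => exact absurd hlt (by have := ha j; rw [Sum.inlₗ] at this; omega)
      | inr j => exact Sum.Lex.inl_lt_inr i j
    rw [hj _ hij, ha]

/-- Elements of a finitely generated subalgebra of a polynomial ring are represented by polynomials
in the generators, linearly and with control of the coefficients at every polyradius. -/
theorem exists_adjoin_section {n ℓ : ℕ} {𝕜 : Type*} [NormedField 𝕜]
    (ρ : Fin ℓ → MvPolynomial (Fin n) 𝕜) :
    ∃ s : MvPolynomial (Fin n) 𝕜 →ₗ[𝕜] MvPolynomial (Fin ℓ) 𝕜,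
      (∀ p ∈ Algebra.adjoin 𝕜 (Set.range ρ), aeval ρ (s p) = p) ∧
      ∀ B : ℝ, 0 ≤ B → ∃ r : Fin n → ℝ, (∀ i, 0 ≤ r i) ∧
        ∀ p, l1Norm (fun _ => B) (s p) ≤ l1Norm r p := by
  classical
  let σ := Fin n ⊕ₗ Fin ℓ
  let φ : MvPolynomial σ 𝕜 →ₐ[𝕜] MvPolynomial (Fin n) 𝕜 :=
    aeval fun i => Sum.elim X ρ (ofLex i)
  let I : Ideal (MvPolynomial σ 𝕜) := RingHom.ker φ
  obtain ⟨G, hG⟩ := exists_isMonicGroebner (MonomialOrder.lex (σ := σ)) I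
  obtain ⟨N, hN₁, hN₂, hN₃, hN₄⟩ := exists_normalForm hG
  let π : MvPolynomial σ 𝕜 →ₐ[𝕜] MvPolynomial (Fin ℓ) 𝕜 :=
    aeval fun i => Sum.elim (fun _ => 0) X (ofLex i)
  let ι : MvPolynomial (Fin n) 𝕜 →ₐ[𝕜] MvPolynomial σ 𝕜 := aeval fun i => X (Sum.inlₗ i)
  let κ : MvPolynomial (Fin ℓ) 𝕜 →ₐ[𝕜] MvPolynomial σ 𝕜 := aeval fun j => X (Sum.inrₗ j)
  have hφι : ∀ p, φ (ι p) = p := fun p =>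
    (AlgHom.congr_fun (algHom_ext (f := φ.comp ι) (g := AlgHom.id 𝕜 _)
      (by intro i; simp [φ, ι, Sum.inlₗ])) p)
  have hφκ : ∀ u, φ (κ u) = aeval ρ u := fun u =>
    (AlgHom.congr_fun (algHom_ext (f := φ.comp κ) (g := aeval ρ)
      (by intro i; simp [φ, κ, Sum.inrₗ])) u)
  have hπκ : ∀ u, π (κ u) = u := fun u =>
    (AlgHom.congr_fun (algHom_ext (f := π.comp κ) (g := AlgHom.id 𝕜 _)
      (by intro i; simp [π, κ, Sum.inrₗ])) u)
  refine ⟨π.toLinearMap ∘ₗ N ∘ₗ ι.toLinearMap, fun p hp => ?_, fun B hB => ?_⟩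
  · rw [Algebra.adjoin_range_eq_range_aeval] at hp
    obtain ⟨u, hu⟩ := hp
    replace hu : aeval ρ u = p := hu
    -- Both lift `p` along `φ`, so they differ by an element of `I` and share a normal form; `κ u`
    -- involves no `X` variables.
    have hNN : N (ι p) = N (κ u) := by
      rw [← sub_eq_zero, ← map_sub]
      refine hN₂ _ ?_
      rw [RingHom.mem_ker, map_sub, hφι, hφκ, hu, sub_self]
    have hκ : ∀ u, κ u = rename Sum.inrₗ u := fun u =>
      (AlgHom.congr_fun (algHom_ext (f := κ) (g := rename Sum.inrₗ) (by intro i; simp [κ])) u)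
    -- Reduction only lowers exponents, and an exponent lex-below an `X`-free one is `X`-free
    -- because the `X` variables come first.
    have hfree : ∀ b ∈ (N (κ u)).support, ∀ i, b (Sum.inlₗ i) = 0 := by
      intro b hb
      obtain ⟨a, ha, hba⟩ := hN₃ _ b hb
      refine lex_inl_free_of_le hba fun i => ?_
      rw [hκ, support_rename_of_injective (by intro x y h; simpa [Sum.inrₗ] using h)] at ha
      obtain ⟨c, _, rfl⟩ := Finset.mem_image.mp ha
      refine Finsupp.mapDomain_of_notMem_range _ _ ?_
      rintro ⟨j, hj⟩
      simp [Sum.inlₗ, Sum.inrₗ] at hj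
    have hvars : ((N (κ u)).vars : Set σ) ⊆ Set.range Sum.inrₗ := by
      intro j hj
      obtain ⟨b, hb, hjb⟩ := (mem_vars_iff_mem_support j).mp hj
      induction j using Lex.rec with
      | _ j =>
      cases j with
      | inl j => exact absurd (hfree b hb j) (Finsupp.mem_support_iff.mp hjb)
      | inr j => exact ⟨j, rfl⟩
    obtain ⟨v, hv⟩ := exists_rename_eq_of_vars_subset_range (N (κ u)) Sum.inrₗ
      (by intro x y h; simpa [Sum.inrₗ] using h) hvars
    have hv' : N (κ u) = κ v := by rw [hκ v]; exact hv.symm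
    have hs : (π.toLinearMap ∘ₗ N ∘ₗ ι.toLinearMap) p = v := by
      simp only [LinearMap.comp_apply, AlgHom.toLinearMap_apply, hNN, hv', hπκ]
    rw [hs, ← hu, ← hφκ, ← hv', ← hφκ]
    have := hN₁ (κ u)
    rw [RingHom.mem_ker, map_sub, sub_eq_zero] at this
    exact this.symm
  · obtain ⟨r, hr, hBr, hgood⟩ := exists_radii_lex G hG.monic B
    refine ⟨fun i => r (Sum.inlₗ i), fun i => hr _, fun p => ?_⟩
    have h1 : l1Norm (fun _ => B) (π (N (ι p))) ≤ l1Norm r (N (ι p)) := by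
      refine l1Norm_aeval_le (fun _ => hB) (fun j => ?_) _
      induction j using Lex.rec with
      | _ j =>
      cases j with
      | inl j => simpa using hr _
      | inr j => simpa [l1Norm_X] using hBr _
    refine h1.trans ((hN₄ r hr hgood _).trans ?_)
    exact l1Norm_aeval_le hr (fun j => (l1Norm_X _ _).le) _

/-! ### Rearrangement into multivariate power series -/

theorem exists_continuousMultilinearMap_monomial {ℓ : ℕ} (J : Fin ℓ → ℕ) {k : ℕ}
    (hk : ∑ j, J j = k) :
    ∃ M : ContinuousMultilinearMap ℝ (fun _ : Fin k => Fin ℓ → ℝ) ℂ, ‖M‖ ≤ 1 ∧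
      ∀ t : Fin ℓ → ℝ, M (fun _ => t) = ∏ j, (t j : ℂ) ^ J j := by
  subst hk
  -- The word in which each index `j` is repeated `J j` times.
  let f : Fin (∑ j, J j) → Fin ℓ := fun i => (finSigmaFinEquiv.symm i).1
  refine ⟨Complex.ofRealCLM.compContinuousMultilinearMap
    ((ContinuousMultilinearMap.mkPiAlgebra ℝ (Fin (∑ j, J j)) ℝ).compContinuousLinearMap
      fun i => ContinuousLinearMap.proj (f i)), ?_, fun t => ?_⟩
  · refine ContinuousMultilinearMap.opNorm_le_bound zero_le_one fun v => ?_
    simp only [ContinuousLinearMap.compContinuousMultilinearMap_coe, Function.comp_apply,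
      ContinuousMultilinearMap.compContinuousLinearMap_apply,
      ContinuousMultilinearMap.mkPiAlgebra_apply, ContinuousLinearMap.proj_apply,
      Complex.ofRealCLM_apply, Complex.norm_real, norm_prod, one_mul]
    exact Finset.prod_le_prod (fun _ _ => norm_nonneg _) fun i _ => norm_le_pi_norm _ _
  · simp only [ContinuousLinearMap.compContinuousMultilinearMap_coe, Function.comp_apply,
      ContinuousMultilinearMap.compContinuousLinearMap_apply,
      ContinuousMultilinearMap.mkPiAlgebra_apply, ContinuousLinearMap.proj_apply,
      Complex.ofRealCLM_apply, Complex.ofReal_prod, f]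
    rw [Equiv.prod_comp finSigmaFinEquiv.symm (fun x => ((t x.1 : ℝ) : ℂ)), Fintype.prod_sigma]
    simp

/-- An everywhere absolutely convergent multivariate power series defines a real analytic
function. -/
theorem analyticOnNhd_of_summable_coeff {ℓ : ℕ} {B : (Fin ℓ → ℕ) → ℂ}
    (hB : ∀ R : ℝ, 0 ≤ R → Summable fun J => ‖B J‖ * R ^ ∑ j, J j)
    {h : (Fin ℓ → ℝ) → ℂ} (hh : ∀ t, HasSum (fun J => B J * ∏ j, (t j : ℂ) ^ J j) (h t)) :
    AnalyticOnNhd ℝ h Set.univ := by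
  classical
  have hex : ∀ (k : ℕ) (J : Fin ℓ → ℕ),
      ∃ M : ContinuousMultilinearMap ℝ (fun _ : Fin k => Fin ℓ → ℝ) ℂ, ‖M‖ ≤ 1 ∧
      (∑ j, J j = k → ∀ t : Fin ℓ → ℝ, M (fun _ => t) = ∏ j, (t j : ℂ) ^ J j) := by
    intro k J
    by_cases hk : ∑ j, J j = k
    · obtain ⟨M, h1, h2⟩ := exists_continuousMultilinearMap_monomial J hk
      exact ⟨M, h1, fun _ => h2⟩
    · exact ⟨0, by simp, fun h => absurd h hk⟩
  choose M hM₁ hM₂ using hex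
  have hfiber : ∀ k : ℕ, (fun J : Fin ℓ → ℕ => ∑ j, J j) ⁻¹' {k}
      = ((Finset.univ : Finset (Fin ℓ)).piAntidiag k : Set (Fin ℓ → ℕ)) := by
    intro k; ext J; simp
  let p : FormalMultilinearSeries ℝ (Fin ℓ → ℝ) ℂ := fun k =>
    ∑ J ∈ (Finset.univ : Finset (Fin ℓ)).piAntidiag k, B J • M k J
  have hp : ∀ k, ‖p k‖ ≤ ∑ J ∈ (Finset.univ : Finset (Fin ℓ)).piAntidiag k, ‖B J‖ := by
    intro k
    refine norm_sum_le_of_le _ fun J _ => ?_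
    rw [norm_smul]
    exact mul_le_of_le_one_right (norm_nonneg _) (hM₁ k J)
  have hrad : p.radius = ⊤ := by
    refine p.radius_eq_top_of_summable_norm fun r => ?_
    have hs := (hB r r.2).hasSum.tsum_fiberwise (fun J : Fin ℓ → ℕ => ∑ j, J j)
    refine Summable.of_nonneg_of_le (fun k => by positivity) (fun k => ?_) hs.summable
    rw [hfiber, Finset.tsum_subtype' _ (fun J : Fin ℓ → ℕ => ‖B J‖ * (r : ℝ) ^ ∑ j, J j)]
    calc ‖p k‖ * (r : ℝ) ^ k
        ≤ (∑ J ∈ (Finset.univ : Finset (Fin ℓ)).piAntidiag k, ‖B J‖) * (r : ℝ) ^ k := by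
          gcongr; exact hp k
      _ = _ := by
          rw [Finset.sum_mul]
          refine Finset.sum_congr rfl fun J hJ => ?_
          rw [(Finset.mem_piAntidiag.mp hJ).1]
  have hps : HasFPowerSeriesOnBall h p 0 ⊤ := by
    refine ⟨hrad.ge, by simp, fun {y} _ => ?_⟩
    rw [zero_add]
    have hs := (hh y).tsum_fiberwise (fun J : Fin ℓ → ℕ => ∑ j, J j)
    convert hs using 2 with k
    rw [hfiber, Finset.tsum_subtype' _ (fun J : Fin ℓ → ℕ => B J * ∏ j, (y j : ℂ) ^ J j)]
    simp only [p, sum_apply, smul_apply,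
      smul_eq_mul]
    exact Finset.sum_congr rfl fun J hJ => by
      rw [hM₂ k J (Finset.mem_piAntidiag.mp hJ).1]
  have := hps.analyticOnNhd
  simpa using this

theorem radiusPow_const {ℓ : ℕ} (R : ℝ) (J : Fin ℓ →₀ ℕ) :
    radiusPow (fun _ => R) J = R ^ ∑ j, J j := by
  rw [radiusPow, Finsupp.prod_fintype _ _ (by simp), Finset.prod_pow_eq_pow_sum]

/-- A series of polynomials whose `ℓ¹` norms are summable at every polyradius converges to an
analytic function, and may be rearranged into a power series. -/
theorem exists_analytic_hasSum {ℓ : ℕ} (b : ℕ → MvPolynomial (Fin ℓ) ℂ)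
    (hb : ∀ R : ℝ, 0 ≤ R → Summable fun m => l1Norm (fun _ => R) (b m)) :
    ∃ h : (Fin ℓ → ℝ) → ℂ, AnalyticOnNhd ℝ h Set.univ ∧
      (∀ t : Fin ℓ → ℝ, HasSum (fun J : Fin ℓ → ℕ =>
        (∑' m, coeff (Finsupp.equivFunOnFinite.symm J) (b m)) * ∏ j, (t j : ℂ) ^ J j) (h t)) ∧
      ∀ t : Fin ℓ → ℝ, HasSum (fun m => eval (fun j => (t j : ℂ)) (b m)) (h t) := by
  classical
  obtain ⟨e, he⟩ : ∃ e : (Fin ℓ →₀ ℕ) ≃ (Fin ℓ → ℕ), e = Finsupp.equivFunOnFinite := ⟨_, rfl⟩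
  have hes : ∀ J j, e.symm J j = J j := by subst he; simp
  rw [← he]
  have hfin : ∀ (R : ℝ) (m : ℕ), HasSum (fun J : Fin ℓ → ℕ => ‖coeff (e.symm J) (b m)‖ *
      R ^ ∑ j, J j) (l1Norm (fun _ => R) (b m)) := by
    intro R m
    have h1 : HasSum (fun a : Fin ℓ →₀ ℕ => ‖coeff a (b m)‖ * radiusPow (fun _ => R) a)
        (l1Norm (fun _ => R) (b m)) := hasSum_sum_of_ne_finset_zero fun a ha => by
      rw [notMem_support_iff.mp ha]; simp
    rw [← e.symm.hasSum_iff] at h1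
    convert h1 using 2 with J
    simp only [Function.comp_apply, radiusPow_const, hes]
  -- Absolute summability over pairs `(m, J)` permits summing in either order: over `m` first for
  -- the coefficients, over `J` first for the original series.
  have habs : ∀ R : ℝ, 0 ≤ R → Summable fun x : ℕ × (Fin ℓ → ℕ) =>
      ‖coeff (e.symm x.2) (b x.1)‖ * R ^ ∑ j, x.2 j := by
    intro R hR
    rw [summable_prod_of_nonneg fun x => by positivity]
    refine ⟨fun m => (hfin R m).summable, ?_⟩
    simp only [(hfin R _).tsum_eq]
    exact hb R hR
  have hterm : ∀ t : Fin ℓ → ℝ, Summable fun x : ℕ × (Fin ℓ → ℕ) =>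
      coeff (e.symm x.2) (b x.1) * ∏ j, (t j : ℂ) ^ x.2 j := by
    intro t
    refine Summable.of_norm_bounded (habs ‖t‖ (norm_nonneg t)) fun x => ?_
    rw [norm_mul, norm_prod, ← Finset.prod_pow_eq_pow_sum]
    refine mul_le_mul_of_nonneg_left (Finset.prod_le_prod (fun _ _ => norm_nonneg _)
      fun j _ => ?_) (norm_nonneg _)
    rw [norm_pow, Complex.norm_real]
    exact pow_le_pow_left₀ (norm_nonneg _) (norm_le_pi_norm t j) _
  obtain ⟨h, hh⟩ : ∃ h : (Fin ℓ → ℝ) → ℂ, ∀ t, HasSum (fun x : ℕ × (Fin ℓ → ℕ) =>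
      coeff (e.symm x.2) (b x.1) * ∏ j, (t j : ℂ) ^ x.2 j) (h t) :=
    ⟨fun t => ∑' x : ℕ × (Fin ℓ → ℕ), coeff (e.symm x.2) (b x.1) * ∏ j, (t j : ℂ) ^ x.2 j,
      fun t => (hterm t).hasSum⟩
  have hcol : ∀ J : Fin ℓ → ℕ, Summable fun m => ‖coeff (e.symm J) (b m)‖ := fun J => by
    have := (habs 1 zero_le_one).prod_symm.prod_factor J
    simpa using this
  have hJ : ∀ t : Fin ℓ → ℝ, HasSum (fun J : Fin ℓ → ℕ =>
      (∑' m, coeff (e.symm J) (b m)) * ∏ j, (t j : ℂ) ^ J j) (h t) := by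
    intro t
    have h1 : HasSum (fun x : (Fin ℓ → ℕ) × ℕ =>
        coeff (e.symm x.1) (b x.2) * ∏ j, (t j : ℂ) ^ x.1 j) (h t) := by
      have h2 := hh t
      rw [← (Equiv.prodComm (Fin ℓ → ℕ) ℕ).hasSum_iff] at h2
      exact h2
    refine h1.prod_fiberwise fun J => ?_
    have h2 : Summable fun m => coeff (e.symm J) (b m) := (hcol J).of_norm
    have h3 := h2.hasSum.mul_right (∏ j, (t j : ℂ) ^ J j)
    exact h3
  refine ⟨h, analyticOnNhd_of_summable_coeff (fun R hR => ?_) hJ, hJ, fun t => ?_⟩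
  · have h1 : Summable fun J : Fin ℓ → ℕ => ∑' m, ‖coeff (e.symm J) (b m)‖ * R ^ ∑ j, J j :=
      (habs R hR).prod_symm.prod
    refine Summable.of_nonneg_of_le (fun J => by positivity) (fun J => ?_) h1
    rw [tsum_mul_right]
    exact mul_le_mul_of_nonneg_right (norm_tsum_le_tsum_norm (hcol J)) (by positivity)
  · refine (hh t).prod_fiberwise fun m => ?_
    have h1 : HasSum (fun a : Fin ℓ →₀ ℕ => coeff a (b m) * ∏ j, (t j : ℂ) ^ a j)
        (eval (fun j => (t j : ℂ)) (b m)) := by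
      rw [eval_eq']
      exact hasSum_sum_of_ne_finset_zero fun a ha => by
        rw [notMem_support_iff.mp ha]; simp
    rw [← e.symm.hasSum_iff] at h1
    simpa only [Function.comp_def, hes] using h1

end MvPolynomial

/-! ### Averages over the compact group -/

section Averaging

variable {n : ℕ} {K : Subgroup (Matrix.orthogonalGroup (Fin n) ℝ)}

theorem abs_orthogonal_mulVec_le (k : K) (ξ : Fin n → ℝ) (i : Fin n) :
    |((k : Matrix (Fin n) (Fin n) ℝ) *ᵥ ξ) i| ≤ ∑ j, |ξ j| := by
  rw [Matrix.mulVec, dotProduct]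
  refine (Finset.abs_sum_le_sum_abs _ _).trans (Finset.sum_le_sum fun j _ => ?_)
  rw [abs_mul]
  exact mul_le_of_le_one_left (abs_nonneg _)
    (entry_norm_bound_of_unitary (𝕜 := ℝ) k.1.2 i j)

theorem continuous_orthogonal_entry (i j : Fin n) :
    Continuous fun k : K => (k : Matrix (Fin n) (Fin n) ℝ) i j :=
  (continuous_subtype_val.comp continuous_subtype_val).matrix_elem i j

theorem continuous_orthogonal_mulVec (ξ : Fin n → ℝ) (i : Fin n) :
    Continuous fun k : K => ((k : Matrix (Fin n) (Fin n) ℝ) *ᵥ ξ) i := by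
  simp only [Matrix.mulVec, dotProduct]
  exact continuous_finsetSum _ fun j _ => (continuous_orthogonal_entry i j).mul continuous_const

/-- Orthogonal matrices have entries of modulus at most one, so each average is at most `‖ξ‖₁^m`;
summing `∏ r (w i)` over words gives `(∑ r i)^m`. -/
theorem l1Norm_sum_words_le [MeasurableSpace K] {μ : Measure K} [IsProbabilityMeasure μ]
    {m : ℕ} {a : (Fin m → Fin n) → MvPolynomial (Fin n) ℝ}
    (ha : ∀ w, ∀ ξ : Fin n → ℝ, MvPolynomial.eval ξ (a w) =
      ∫ k : K, ∏ i, ((k : Matrix (Fin n) (Fin n) ℝ) *ᵥ ξ) (w i) ∂μ) (ξ : Fin n → ℝ)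
    {r : Fin n → ℝ} (hr : ∀ i, 0 ≤ r i) :
    MvPolynomial.l1Norm r (∑ w, MvPolynomial.C (MvPolynomial.eval ξ (a w)) *
      ∏ i, MvPolynomial.X (w i)) ≤ ((∑ j, |ξ j|) * ∑ i, r i) ^ m := by
  classical
  have hbound : ∀ w, |MvPolynomial.eval ξ (a w)| ≤ (∑ j, |ξ j|) ^ m := by
    intro w
    rw [ha]
    have := norm_integral_le_of_norm_le_const (μ := μ) (C := (∑ j, |ξ j|) ^ m)
      (f := fun k : K => ∏ i, ((k : Matrix (Fin n) (Fin n) ℝ) *ᵥ ξ) (w i))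
      (Filter.Eventually.of_forall fun k => by
        rw [norm_prod]
        refine (Finset.prod_le_prod (fun _ _ => norm_nonneg _) fun i _ =>
          abs_orthogonal_mulVec_le k ξ (w i)).trans ?_
        simp)
    simpa using this
  calc _ ≤ ∑ w : Fin m → Fin n, (∑ j, |ξ j|) ^ m * ∏ i, r (w i) := by
        refine (MvPolynomial.l1Norm_sum_le hr _ _).trans (Finset.sum_le_sum fun w _ => ?_)
        refine (MvPolynomial.l1Norm_C_mul_le hr _ _).trans (mul_le_mul (hbound w) ?_
          (MvPolynomial.l1Norm_nonneg hr _) (by positivity))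
        simpa [MvPolynomial.l1Norm_X] using MvPolynomial.l1Norm_prod_le (𝕜 := ℝ) hr Finset.univ
          (fun i => MvPolynomial.X (w i))
    _ = ((∑ j, |ξ j|) * ∑ i, r i) ^ m := by
        rw [mul_pow, ← Finset.mul_sum, ← Fin.prod_const m (∑ i, r i), Finset.prod_univ_sum,
          Fintype.piFinset_univ]

theorem hasSum_integral_cexp [MeasurableSpace K] [BorelSpace K] (μ : Measure K)
    [IsProbabilityMeasure μ] (ξ x : Fin n → ℝ) :
    HasSum (fun m : ℕ => Complex.I ^ m / (m.factorial : ℂ) *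
      ((∫ k : K, (x ⬝ᵥ ((k : Matrix (Fin n) (Fin n) ℝ) *ᵥ ξ)) ^ m ∂μ : ℝ) : ℂ))
      (∫ k : K, Complex.exp (Complex.I *
        ((x ⬝ᵥ ((k : Matrix (Fin n) (Fin n) ℝ) *ᵥ ξ) : ℝ) : ℂ)) ∂μ) := by
  have hcont : Continuous fun k : K => x ⬝ᵥ ((k : Matrix (Fin n) (Fin n) ℝ) *ᵥ ξ) :=
    continuous_finsetSum _ fun i _ => continuous_const.mul (continuous_orthogonal_mulVec ξ i)
  let T : ℝ := ∑ i, |x i| * ∑ j, |ξ j|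
  have hT : ∀ k : K, |x ⬝ᵥ ((k : Matrix (Fin n) (Fin n) ℝ) *ᵥ ξ)| ≤ T := fun k => by
    rw [dotProduct]
    refine (Finset.abs_sum_le_sum_abs _ _).trans (Finset.sum_le_sum fun i _ => ?_)
    rw [abs_mul]
    exact mul_le_mul_of_nonneg_left (abs_orthogonal_mulVec_le k ξ i) (abs_nonneg _)
  have h := hasSum_integral_of_dominated_convergence (μ := μ)
    (F := fun (m : ℕ) (k : K) => Complex.I ^ m / (m.factorial : ℂ) *
      (((x ⬝ᵥ ((k : Matrix (Fin n) (Fin n) ℝ) *ᵥ ξ)) ^ m : ℝ) : ℂ))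
    (f := fun k : K => Complex.exp (Complex.I *
        ((x ⬝ᵥ ((k : Matrix (Fin n) (Fin n) ℝ) *ᵥ ξ) : ℝ) : ℂ)))
    (fun m _ => T ^ m / m.factorial) (fun m => ?_) (fun m => ?_) ?_ ?_ ?_
  · refine Eq.subst (motive := fun f => HasSum f _) (funext fun m => ?_) h
    rw [integral_const_mul, integral_complex_ofReal]
  · exact (continuous_const.mul
      (Complex.continuous_ofReal.comp (hcont.pow m))).aestronglyMeasurable
  · refine Filter.Eventually.of_forall fun k => ?_
    rw [norm_mul, norm_div, norm_pow, Complex.norm_I, one_pow, Complex.norm_natCast,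
      Complex.norm_real, norm_pow, one_div, inv_mul_eq_div]
    gcongr
    exact hT k
  · exact Filter.Eventually.of_forall fun k => Real.summable_pow_div_factorial T
  · exact integrable_const _
  · refine Filter.Eventually.of_forall fun k => ?_
    have := NormedSpace.expSeries_div_hasSum_exp (𝔸 := ℂ) (Complex.I *
        ((x ⬝ᵥ ((k : Matrix (Fin n) (Fin n) ℝ) *ᵥ ξ) : ℝ) : ℂ))
    rw [← Complex.exp_eq_exp_ℂ] at this
    refine Eq.subst (motive := fun f => HasSum f _) (funext fun m => ?_) this
    rw [mul_pow, Complex.ofReal_pow, div_mul_eq_mul_div]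

variable [MeasurableSpace K] [BorelSpace K] [CompactSpace K] (μ : Measure K) [IsProbabilityMeasure μ]

theorem integrable_of_continuous_compactSpace {E : Type*} [NormedAddCommGroup E]
    [SecondCountableTopology E] {f : K → E} (hf : Continuous f) : Integrable f μ :=
  hf.integrable_of_hasCompactSupport (HasCompactSupport.of_compactSpace f)

/-- Compact groups are unimodular: a right translate of `μ` is again a Haar probability measure, and
that is unique. -/
theorem integral_mul_right_eq_self_of_compactSpace [μ.IsHaarMeasure] (f : K → ℝ) (g : K) :
    ∫ k, f (k * g) ∂μ = ∫ k, f k ∂μ := by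
  have h1 : IsProbabilityMeasure (μ.map (· * g)) :=
    Measure.isProbabilityMeasure_map (measurable_mul_const g).aemeasurable
  have h2 : μ.map (· * g) = μ := Measure.isHaarMeasure_eq_of_isProbabilityMeasure _ _
  conv_rhs => rw [← h2]
  exact ((Homeomorph.mulRight g).measurableEmbedding.integral_map f).symm

theorem dotProduct_orthogonal_mulVec (g : Matrix.orthogonalGroup (Fin n) ℝ)
    (x y : Fin n → ℝ) :
    ((g : Matrix (Fin n) (Fin n) ℝ) *ᵥ x) ⬝ᵥ y
      = x ⬝ᵥ (((g⁻¹ : Matrix.orthogonalGroup (Fin n) ℝ) : Matrix (Fin n) (Fin n) ℝ) *ᵥ y) := by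
  have : ((g⁻¹ : Matrix.orthogonalGroup (Fin n) ℝ) : Matrix (Fin n) (Fin n) ℝ)
      = (g : Matrix (Fin n) (Fin n) ℝ)ᵀ := by
    simp [Matrix.star_eq_conjTranspose]
  rw [this, Matrix.dotProduct_mulVec, Matrix.vecMul_transpose]

/-- The average over `K` of a monomial, given by a word in the coordinates, is an invariant
polynomial. -/
theorem exists_invariant_average [μ.IsHaarMeasure] {m : ℕ} (w : Fin m → Fin n) :
    ∃ a ∈ invariantPolynomials K, ∀ ξ : Fin n → ℝ, MvPolynomial.eval ξ a =
      ∫ k : K, ∏ i, ((k : Matrix (Fin n) (Fin n) ℝ) *ᵥ ξ) (w i) ∂μ := by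
  classical
  let a : MvPolynomial (Fin n) ℝ := ∑ v : Fin m → Fin n,
    MvPolynomial.C (∫ k : K, ∏ i, (k : Matrix (Fin n) (Fin n) ℝ) (w i) (v i) ∂μ) *
      ∏ i, MvPolynomial.X (v i)
  have ha : ∀ ξ : Fin n → ℝ, MvPolynomial.eval ξ a =
      ∫ k : K, ∏ i, ((k : Matrix (Fin n) (Fin n) ℝ) *ᵥ ξ) (w i) ∂μ := by
    intro ξ
    have h1 : ∀ k : K, ∏ i, ((k : Matrix (Fin n) (Fin n) ℝ) *ᵥ ξ) (w i) =
        ∑ v : Fin m → Fin n, (∏ i, (k : Matrix (Fin n) (Fin n) ℝ) (w i) (v i)) *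
          ∏ i, ξ (v i) := by
      intro k
      simp only [Matrix.mulVec, dotProduct, Finset.prod_univ_sum, Fintype.piFinset_univ,
        Finset.prod_mul_distrib]
    have h2 : ∀ v : Fin m → Fin n, Continuous fun k : K =>
        (∏ i, (k : Matrix (Fin n) (Fin n) ℝ) (w i) (v i)) * ∏ i, ξ (v i) := fun v =>
      (continuous_finsetProd _ fun i _ => continuous_orthogonal_entry _ _).mul continuous_const
    rw [integral_congr_ae (Filter.Eventually.of_forall h1), integral_finsetSum _ fun v _ =>
      integrable_of_continuous_compactSpace μ (h2 v)]
    simp only [a, map_sum, map_mul, map_prod, MvPolynomial.eval_C, MvPolynomial.eval_X,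
      integral_mul_const]
  refine ⟨a, fun g hg x => ?_, ha⟩
  -- Invariance in `ξ` comes from right translation, since `k(gξ) = (kg)ξ`.
  rw [ha, ha, ← integral_mul_right_eq_self_of_compactSpace μ
    (fun k : K => ∏ i, ((k : Matrix (Fin n) (Fin n) ℝ) *ᵥ x) (w i)) ⟨g, hg⟩]
  simp [Matrix.mulVec_mulVec]

theorem dotProduct_pow_eq_sum_words (x y : Fin n → ℝ) (m : ℕ) :
    (x ⬝ᵥ y) ^ m = ∑ w : Fin m → Fin n, (∏ i, y (w i)) * ∏ i, x (w i) := by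
  classical
  rw [dotProduct, ← Fin.prod_const, Finset.prod_univ_sum, Fintype.piFinset_univ]
  exact Finset.sum_congr rfl fun w _ => by rw [Finset.prod_mul_distrib, mul_comm]

variable {μ} in
-- Expanding the power over words separates the variables: `ξ` enters only through the invariant
-- coefficients `a w`.
theorem eval_sum_words {m : ℕ} {a : (Fin m → Fin n) → MvPolynomial (Fin n) ℝ}
    (ha : ∀ w, ∀ ξ : Fin n → ℝ, MvPolynomial.eval ξ (a w) =
      ∫ k : K, ∏ i, ((k : Matrix (Fin n) (Fin n) ℝ) *ᵥ ξ) (w i) ∂μ) (ξ x : Fin n → ℝ) :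
    MvPolynomial.eval x (∑ w, MvPolynomial.C (MvPolynomial.eval ξ (a w)) *
      ∏ i, MvPolynomial.X (w i)) =
      ∫ k : K, (x ⬝ᵥ ((k : Matrix (Fin n) (Fin n) ℝ) *ᵥ ξ)) ^ m ∂μ := by
  simp only [dotProduct_pow_eq_sum_words]
  have h : ∀ w : Fin m → Fin n, Continuous fun k : K =>
      (∏ i, ((k : Matrix (Fin n) (Fin n) ℝ) *ᵥ ξ) (w i)) * ∏ i, x (w i) := fun w =>
    (continuous_finsetProd _ fun i _ => continuous_orthogonal_mulVec _ _).mul continuous_const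
  rw [integral_finsetSum _ fun w _ => integrable_of_continuous_compactSpace μ (h w)]
  simp only [map_sum, map_mul, map_prod, MvPolynomial.eval_C, MvPolynomial.eval_X,
    integral_mul_const, ha]

variable {μ} in
theorem sum_words_mem_invariantPolynomials [μ.IsHaarMeasure] {m : ℕ}
    {a : (Fin m → Fin n) → MvPolynomial (Fin n) ℝ}
    (ha : ∀ w, ∀ ξ : Fin n → ℝ, MvPolynomial.eval ξ (a w) =
      ∫ k : K, ∏ i, ((k : Matrix (Fin n) (Fin n) ℝ) *ᵥ ξ) (w i) ∂μ) (ξ : Fin n → ℝ) :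
    (∑ w, MvPolynomial.C (MvPolynomial.eval ξ (a w)) *
      ∏ i, MvPolynomial.X (w i)) ∈ invariantPolynomials K := by
  intro g hg x
  -- Invariance in `x` comes from left translation, since `⟨gx, kξ⟩ = ⟨x, g⁻¹kξ⟩`.
  rw [eval_sum_words ha, eval_sum_words ha, ← integral_mul_left_eq_self
    (fun k : K => (x ⬝ᵥ ((k : Matrix (Fin n) (Fin n) ℝ) *ᵥ ξ)) ^ m) (⟨g, hg⟩⁻¹ : K)]
  simp only [dotProduct_orthogonal_mulVec, Subgroup.coe_mul, Subgroup.coe_inv,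
    Submonoid.coe_mul, Matrix.mulVec_mulVec]

end Averaging

/-! ### Gradings and change of scalars -/

namespace MvPolynomial

/-- With the `j`-th variable in weight `d j`, substituting `ρ` is a graded map. -/
theorem aeval_weightedHomogeneousComponent {n ℓ : ℕ} {R : Type*} [CommSemiring R]
    {ρ : Fin ℓ → MvPolynomial (Fin n) R} {d : Fin ℓ → ℕ} (hd : ∀ j, (ρ j).IsHomogeneous (d j))
    (m : ℕ) (u : MvPolynomial (Fin ℓ) R) :
    aeval ρ (weightedHomogeneousComponent d m u) = homogeneousComponent m (aeval ρ u) := by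
  classical
  induction u using MvPolynomial.induction_on' with
  | monomial a c =>
    have h1 : (aeval ρ (monomial a c)).IsHomogeneous (Finsupp.weight d a) := by
      rw [aeval_monomial, ← zero_add (Finsupp.weight d a), Finsupp.weight_apply]
      refine IsHomogeneous.mul (isHomogeneous_C _ c) (IsHomogeneous.prod _ _ _ fun j _ => ?_)
      simp only [smul_eq_mul]
      rw [mul_comm]
      exact (hd j).pow _
    rw [homogeneousComponent_of_mem h1, weightedHomogeneousComponent_of_mem
      (isWeightedHomogeneous_monomial d a c rfl)]
    split_ifs <;> simp
  | add p q hp hq => simp only [map_add, hp, hq]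

theorem l1Norm_weightedHomogeneousComponent_le {σ 𝕜 : Type*} [NormedField 𝕜] {r : σ → ℝ}
    (hr : ∀ i, 0 ≤ r i) (d : σ → ℕ) (m : ℕ) (u : MvPolynomial σ 𝕜) :
    l1Norm r (weightedHomogeneousComponent d m u) ≤ l1Norm r u := by
  classical
  rw [weightedHomogeneousComponent_apply]
  refine (l1Norm_sum_le hr _ _).trans ?_
  simp only [l1Norm_monomial]
  exact Finset.sum_le_sum_of_subset_of_nonneg (Finset.filter_subset _ _)
    fun a _ _ => mul_nonneg (norm_nonneg _) (radiusPow_nonneg hr a)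

theorem l1Norm_map_ofReal {σ : Type*} (r : σ → ℝ) (p : MvPolynomial σ ℝ) :
    l1Norm r (map Complex.ofRealHom p) = l1Norm r p := by
  rw [l1Norm, support_map_of_injective _ Complex.ofReal_injective, l1Norm]
  simp [coeff_map]

theorem eval_ofReal_map {σ : Type*} (t : σ → ℝ) (p : MvPolynomial σ ℝ) :
    eval (fun j => (t j : ℂ)) (map Complex.ofRealHom p) = ((eval t p : ℝ) : ℂ) := by
  rw [eval_map]
  exact (eval₂_comp_left Complex.ofRealHom (RingHom.id ℝ) t p).symm

theorem eval_polyMap {n ℓ : ℕ} (ρ : Fin ℓ → MvPolynomial (Fin n) ℝ) (x : Fin n → ℝ)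
    (u : MvPolynomial (Fin ℓ) ℝ) : eval (polyMap ρ x) u = eval x (aeval ρ u) := by
  have : (aeval (polyMap ρ x) : MvPolynomial (Fin ℓ) ℝ →ₐ[ℝ] ℝ)
      = (aeval x : MvPolynomial (Fin n) ℝ →ₐ[ℝ] ℝ).comp (aeval ρ) :=
    algHom_ext fun j => by simp [polyMap]
  simpa using AlgHom.congr_fun this u

end MvPolynomial

/-! ### From the Taylor expansion to the theorem -/

/-- Invariant polynomials whose evaluations at `ξ` are the averages over `K` of the monomials
`∏ i, (k ξ) (w i)`, indexed by words `w`. -/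
structure IsAverageFamily {n : ℕ} (K : Subgroup (Matrix.orthogonalGroup (Fin n) ℝ))
    (hK : IsCompact (K : Set (Matrix.orthogonalGroup (Fin n) ℝ)))
    (a : (m : ℕ) → (Fin m → Fin n) → MvPolynomial (Fin n) ℝ) : Prop where
  mem : ∀ m w, a m w ∈ invariantPolynomials K
  sum_mem : ∀ m (ξ : Fin n → ℝ), (∑ w, MvPolynomial.C (MvPolynomial.eval ξ (a m w)) *
    ∏ i, MvPolynomial.X (w i)) ∈ invariantPolynomials K
  l1Norm_le : ∀ m (ξ r : Fin n → ℝ), (∀ i, 0 ≤ r i) →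
    MvPolynomial.l1Norm r (∑ w, MvPolynomial.C (MvPolynomial.eval ξ (a m w)) *
      ∏ i, MvPolynomial.X (w i)) ≤ ((∑ j, |ξ j|) * ∑ i, r i) ^ m
  hasSum : ∀ ξ x : Fin n → ℝ, HasSum (fun m : ℕ => Complex.I ^ m / (m.factorial : ℂ) *
    ((MvPolynomial.eval x (∑ w, MvPolynomial.C (MvPolynomial.eval ξ (a m w)) *
      ∏ i, MvPolynomial.X (w i)) : ℝ) : ℂ)) (sphericalFunction K hK ξ x)

theorem exists_isAverageFamily {n : ℕ} (K : Subgroup (Matrix.orthogonalGroup (Fin n) ℝ))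
    (hK : IsCompact (K : Set (Matrix.orthogonalGroup (Fin n) ℝ))) :
    ∃ a, IsAverageFamily K hK a := by
  let _ : MeasurableSpace K := borel K
  have : BorelSpace K := ⟨rfl⟩
  have : CompactSpace K := isCompact_iff_compactSpace.mp hK
  let μ : Measure K := normalizedHaar K hK
  have hμ : μ = Measure.haarMeasure ⊤ := rfl
  have : μ.IsHaarMeasure := by rw [hμ]; infer_instance
  have : IsProbabilityMeasure μ := ⟨by
    rw [hμ]; exact Measure.haarMeasure_self (K₀ := (⊤ : TopologicalSpace.PositiveCompacts K))⟩
  choose a ha₁ ha₂ using fun (m : ℕ) (w : Fin m → Fin n) => exists_invariant_average μ w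
  refine ⟨a, ha₁, fun m ξ => sum_words_mem_invariantPolynomials (ha₂ m) ξ,
    fun m ξ r hr => l1Norm_sum_words_le (ha₂ m) ξ hr, fun ξ x => ?_⟩
  refine Eq.subst (motive := fun f => HasSum f _) (funext fun m => ?_)
    (hasSum_integral_cexp μ ξ x)
  rw [eval_sum_words (ha₂ m)]

/-- Linear maps expressing the homogeneous invariants of degree `m` through the generators, with
coefficient bounds uniform in `m`, turn the Taylor expansion of a spherical function into a
power series in the generators. -/
theorem exists_powerSeries_of_section {n ℓ : ℕ}
    {K : Subgroup (Matrix.orthogonalGroup (Fin n) ℝ)}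
    {hK : IsCompact (K : Set (Matrix.orthogonalGroup (Fin n) ℝ))}
    {a : (m : ℕ) → (Fin m → Fin n) → MvPolynomial (Fin n) ℝ} (ha : IsAverageFamily K hK a)
    {ρ : Fin ℓ → MvPolynomial (Fin n) ℝ}
    {s : ℕ → MvPolynomial (Fin n) ℝ →ₗ[ℝ] MvPolynomial (Fin ℓ) ℝ}
    (hs : ∀ m, ∀ p ∈ invariantPolynomials K, p.IsHomogeneous m →
      MvPolynomial.aeval ρ (s m p) = p)
    (hbound : ∀ B : ℝ, 0 ≤ B → ∃ r : Fin n → ℝ, (∀ i, 0 ≤ r i) ∧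
      ∀ m p, MvPolynomial.l1Norm (fun _ => B) (s m p) ≤ MvPolynomial.l1Norm r p)
    (ξ : Fin n → ℝ) :
    ∃ h : (Fin ℓ → ℝ) → ℂ, AnalyticOnNhd ℝ h Set.univ ∧
      (∀ t : Fin ℓ → ℝ, HasSum (fun J : Fin ℓ → ℕ =>
        (∑' m : ℕ, Complex.I ^ m / (m.factorial : ℂ) *
          ((MvPolynomial.coeff (Finsupp.equivFunOnFinite.symm J)
            (s m (∑ w, MvPolynomial.C (MvPolynomial.eval ξ (a m w)) *
              ∏ i, MvPolynomial.X (w i))) : ℝ) : ℂ)) *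
          ∏ j, (t j : ℂ) ^ J j) (h t)) ∧
      ∀ x : Fin n → ℝ, sphericalFunction K hK ξ x = h (polyMap ρ x) := by
  let P : ℕ → MvPolynomial (Fin n) ℝ := fun m =>
    ∑ w : Fin m → Fin n, MvPolynomial.C (MvPolynomial.eval ξ (a m w)) *
      ∏ i, MvPolynomial.X (w i)
  have hP : ∀ m, (P m).IsHomogeneous m := fun m =>
    MvPolynomial.IsHomogeneous.sum _ _ _ fun w _ => by
      have h1 : (∏ i, MvPolynomial.X (w i) : MvPolynomial (Fin n) ℝ).IsHomogeneous m := by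
        simpa using MvPolynomial.IsHomogeneous.prod Finset.univ
          (fun i => (MvPolynomial.X (w i) : MvPolynomial (Fin n) ℝ)) (fun _ => 1)
          (fun i _ => MvPolynomial.isHomogeneous_X ℝ (w i))
      simpa using (MvPolynomial.isHomogeneous_C (Fin n) (MvPolynomial.eval ξ (a m w))).mul h1
  let b : ℕ → MvPolynomial (Fin ℓ) ℂ := fun m =>
    MvPolynomial.C (Complex.I ^ m / (m.factorial : ℂ)) *
      MvPolynomial.map Complex.ofRealHom (s m (P m))
  have hb : ∀ R : ℝ, 0 ≤ R → Summable fun m => MvPolynomial.l1Norm (fun _ => R) (b m) := by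
    intro R hR
    obtain ⟨r, hr, hrs⟩ := hbound R hR
    refine Summable.of_nonneg_of_le (fun m => MvPolynomial.l1Norm_nonneg (fun _ => hR) _)
      (fun m => ?_) (Real.summable_pow_div_factorial ((∑ j, |ξ j|) * ∑ i, r i))
    refine (MvPolynomial.l1Norm_C_mul_le (fun _ => hR) _ _).trans ?_
    rw [MvPolynomial.l1Norm_map_ofReal, norm_div, norm_pow, Complex.norm_I, one_pow,
      Complex.norm_natCast, one_div, inv_mul_eq_div]
    gcongr
    exact (hrs m (P m)).trans (ha.l1Norm_le m ξ r hr)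
  obtain ⟨h, h₁, h₂, h₃⟩ := MvPolynomial.exists_analytic_hasSum b hb
  refine ⟨h, h₁, fun t => ?_, fun x => (ha.hasSum ξ x).unique ?_⟩
  · simpa only [b, P, MvPolynomial.coeff_C_mul, MvPolynomial.coeff_map,
      Complex.ofRealHom_eq_coe] using h₂ t
  · refine Eq.subst (motive := fun f => HasSum f _) (funext fun m => ?_) (h₃ (polyMap ρ x))
    simp only [b, map_mul, MvPolynomial.eval_C]
    rw [MvPolynomial.eval_ofReal_map, MvPolynomial.eval_polyMap,
      hs m (P m) (ha.sum_mem m ξ) (hP m)]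

theorem proposition1p2 {n ℓ : ℕ} (K : Subgroup (Matrix.orthogonalGroup (Fin n) ℝ))
    (hK : IsCompact (K : Set (Matrix.orthogonalGroup (Fin n) ℝ)))
    (ρ : Fin ℓ → MvPolynomial (Fin n) ℝ)
    (hρ : Algebra.adjoin ℝ (Set.range ρ) = invariantPolynomials K) :
    (∀ ξ : Fin n → ℝ, ∃ h : (Fin ℓ → ℝ) → ℂ,
      AnalyticOnNhd ℝ h Set.univ ∧
      ∀ x : Fin n → ℝ, sphericalFunction K hK ξ x = h (polyMap ρ x)) ∧
    ((∀ j, ∃ d : ℕ, (ρ j).IsHomogeneous d) →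
      ∃ q : (Fin ℓ → ℕ) → MvPolynomial (Fin ℓ) ℂ, ∀ ξ : Fin n → ℝ,
        ∃ h : (Fin ℓ → ℝ) → ℂ,
          AnalyticOnNhd ℝ h Set.univ ∧
          (∀ t : Fin ℓ → ℝ,
            HasSum (fun J : Fin ℓ → ℕ =>
              MvPolynomial.eval (fun j => ((polyMap ρ ξ j : ℝ) : ℂ)) (q J) *
                ∏ j, ((t j : ℝ) : ℂ) ^ J j) (h t)) ∧
          ∀ x : Fin n → ℝ, sphericalFunction K hK ξ x = h (polyMap ρ x)) := by
  classical
  obtain ⟨s, hs, hbound⟩ := MvPolynomial.exists_adjoin_section ρ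
  rw [hρ] at hs
  obtain ⟨a, ha⟩ := exists_isAverageFamily K hK
  refine ⟨fun ξ => ?_, fun hhom => ?_⟩
  · obtain ⟨h, h₁, _, h₃⟩ := exists_powerSeries_of_section ha (s := fun _ => s)
      (fun _ p hp _ => hs p hp)
      (fun B hB => (hbound B hB).imp fun r hr => ⟨hr.1, fun _ p => hr.2 p⟩) ξ
    exact ⟨h, h₁, h₃⟩
  · choose d hd using hhom
    -- Truncating to weight `m` still represents invariants homogeneous of degree `m`, and dropping
    -- monomials cannot increase the norm.
    let s' : ℕ → MvPolynomial (Fin n) ℝ →ₗ[ℝ] MvPolynomial (Fin ℓ) ℝ := fun m =>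
      MvPolynomial.weightedHomogeneousComponent d m ∘ₗ s
    have hQ : ∀ m (w : Fin m → Fin n), ∃ Q : MvPolynomial (Fin ℓ) ℝ,
        ∀ ξ, MvPolynomial.eval (polyMap ρ ξ) Q = MvPolynomial.eval ξ (a m w) := fun m w =>
      ⟨s (a m w), fun ξ => by rw [MvPolynomial.eval_polyMap, hs _ (ha.mem m w)]⟩
    choose Q hQ using hQ
    let e : (Fin ℓ → ℕ) → Fin ℓ →₀ ℕ := fun J => Finsupp.equivFunOnFinite.symm J
    -- Only `m = weight d J` contributes to the coefficient of `T^J`. Linearity of `s'` moves the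
    -- `ξ`-dependence into the scalars `a m w`, which `Q m w` writes in terms of `ρ(ξ)`.
    let q : (Fin ℓ → ℕ) → MvPolynomial (Fin ℓ) ℂ := fun J =>
      let m := Finsupp.weight d (e J)
      MvPolynomial.C (Complex.I ^ m / (m.factorial : ℂ)) * MvPolynomial.map Complex.ofRealHom
        (∑ w : Fin m → Fin n, Q m w *
          MvPolynomial.C (MvPolynomial.coeff (e J) (s' m (∏ i, MvPolynomial.X (w i)))))
    refine ⟨q, fun ξ => ?_⟩
    obtain ⟨h, h₁, h₂, h₃⟩ := exists_powerSeries_of_section ha (s := s')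
      (fun m p hp hpm => by
        simp only [s', LinearMap.comp_apply]
        rw [MvPolynomial.aeval_weightedHomogeneousComponent hd, hs p hp,
          MvPolynomial.homogeneousComponent_of_mem hpm, if_pos rfl])
      (fun B hB => (hbound B hB).imp fun r hr => ⟨hr.1, fun m p =>
        (MvPolynomial.l1Norm_weightedHomogeneousComponent_le (fun _ => hB) d m (s p)).trans
          (hr.2 p)⟩) ξ
    refine ⟨h, h₁, fun t => ?_, h₃⟩
    refine Eq.subst (motive := fun f => HasSum f _) (funext fun J => ?_) (h₂ t)
    congr 1
    rw [tsum_eq_single (Finsupp.weight d (e J))]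
    · simp only [q, map_mul, MvPolynomial.eval_C]
      rw [MvPolynomial.eval_ofReal_map]
      congr 2
      simp only [← MvPolynomial.smul_eq_C_mul, map_sum, map_smul, MvPolynomial.coeff_sum,
        MvPolynomial.coeff_smul, map_mul, MvPolynomial.eval_C, hQ, smul_eq_mul]
      rfl
    · intro m hm
      simp only [s', LinearMap.comp_apply]
      rw [MvPolynomial.coeff_weightedHomogeneousComponent, if_neg (Ne.symm hm)]
      simp
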